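/- Let $d\ge 1$, let $\Omega\subset\mathbb{R}^d$ be a bounded open set, let $\mathcal{A}$ be a nonempty compact metric space, and let $a\in C(\overline{\Omega}\times\mathcal{A};\mathbb{R}^{d\times d}_{\mathrm{sym}})$ and $f\in C(\overline{\Omega}\times\mathcal{A})$. Write $A:B=\sum_{i,j}A_{ij}B_{ij}$ and define the Hamiltonian and its partial subdifferential by $$H(x,M)=\sup_{\alpha\in\mathcal{A}}\{-a(x,\alpha):M-f(x,\alpha)\},$$ $$\partial_M H(x,M)=\{A\in\mathbb{R}^{d\times d}_{\mathrm{sym}} : H(x,M)+A:(\widetilde M-M)\le H(x,\widetilde M)\ \ \forall \widetilde M\in\mathbb{R}^{d\times d}_{\mathrm{sym}}\}.$$ Let $V=H^2(\Omega)\cap H^1_0(\Omega)$ with the $H^2$-norm, let $V^*$ be its dual, and for $v\in V$ put $H[v](x)=H(x,D^2v(x))$ and $$\mathcal{D}H[v]=\{A\in L^\infty(\Omega;\mathbb{R}^{d\times d}_{\mathrm{sym}}) : A(x)\in\partial_M H(x,D^2v(x))\text{ for a.e. }x\in\Omega\}.$$ Let $F\colon L^2(\Omega)\to L^2(\Omega)$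 be an arbitrary map and let $G\in V^*$. A pair $(u,m)\in V\times L^2(\Omega)$ is a *PDI solution* if there exists $\overline a$ with $-\overline a\in\mathcal{D}H[u]$ such that $$H[u]=F[m]\ \text{ a.e. in }\Omega,\qquad \int_\Omega m\,(-\overline a:D^2v)\,\mathrm{d}x=\langle G,v\rangle_{V^*\times V}\quad\forall v\in V.$$ A pair $(u,m)\in V\times L^2(\Omega)$ is a *VI solution* if $m\ge 0$ a.e. in $\Omega$ and $$H[u]=F[m]\ \text{ a.e. in }\Omega,\qquad \langle G,v-u\rangle_{V^*\times V}\le\int_\Omega m\,(H[v]-H[u])\,\mathrm{d}x\quad\forall v\in V.$$ **Theorem.** If $(u,m)\in V\times L^2(\Omega)$ is a PDI solution and $m\ge0$ a.e. in $\Omega$, then $(u,m)$ is a VI solution. Conversely, every VI solution $(u,m)$ is a PDI solution. -/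

import Mathlib

open MeasureTheory
open scoped ENNReal ContDiff

namespace MeanFieldGame

noncomputable section

/-- The space `ℝ^d` with its Euclidean norm. -/
abbrev Space (d : ℕ) : Type := EuclideanSpace ℝ (Fin d)

/-- The space `ℝ^{d × d}`; the symmetric matrices in it are singled out by `Matrix.IsSymm`. -/
abbrev Mat (d : ℕ) : Type := Matrix (Fin d) (Fin d) ℝ

/-- The Frobenius inner product `A : B`. -/
def frob {d : ℕ} (A B : Mat d) : ℝ := ∑ i, ∑ j, A i j * B i j

/-! ### Sobolev spaces -/

/-- `L²(Ω)`, for the Lebesgue measure. -/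
abbrev L2 {d : ℕ} (Ω : Set (Space d)) : Type := Lp ℝ 2 (volume.restrict Ω)

/-- `L^∞(Ω)`, for the Lebesgue measure. -/
abbrev LInfty {d : ℕ} (Ω : Set (Space d)) : Type := Lp ℝ ∞ (volume.restrict Ω)

/-- Test functions: the elements of `C_c^∞(Ω)`. -/
structure IsTest {d : ℕ} (Ω : Set (Space d)) (φ : Space d → ℝ) : Prop where
  contDiff : ContDiff ℝ ∞ φ
  hasCompactSupport : HasCompactSupport φ
  tsupport_subset : tsupport φ ⊆ Ω

/-- The classical partial derivative `∂φ/∂x_i`. -/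
def pderiv {d : ℕ} (i : Fin d) (φ : Space d → ℝ) (x : Space d) : ℝ :=
  fderiv ℝ φ x (EuclideanSpace.single i 1)

/-- `w` is the weak partial derivative `∂g/∂x_i` of `g` in `Ω`. -/
def IsWeakDeriv {d : ℕ} (Ω : Set (Space d)) (i : Fin d) (g w : L2 Ω) : Prop :=
  ∀ φ : Space d → ℝ, IsTest Ω φ →
    ∫ x in Ω, g x * pderiv i φ x = - ∫ x in Ω, w x * φ x

/-- Pairs `(v, (g_i)_i)` in `L²(Ω) × L²(Ω)^d`, with the Hilbert product norm. -/
abbrev Jet1 {d : ℕ} (Ω : Set (Space d)) : Type :=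
  WithLp 2 (L2 Ω × PiLp 2 (fun _ : Fin d => L2 Ω))

/-- Triples `((v, (g_i)_i), (h_{ij})_{ij})` of elements of `L²(Ω)`, `L²(Ω)^d` and
`L²(Ω)^{d × d}`, with the Hilbert product norm. -/
abbrev Jet2 {d : ℕ} (Ω : Set (Space d)) : Type :=
  WithLp 2 (Jet1 Ω × PiLp 2 (fun _ : Fin d × Fin d => L2 Ω))

section Helpers

variable {d : ℕ} {Ω : Set (Space d)}

theorem IsTest.zero : IsTest Ω (0 : Space d → ℝ) :=
  ⟨contDiff_const, HasCompactSupport.zero, by simp [tsupport]⟩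

theorem IsTest.add {φ ψ : Space d → ℝ} (hφ : IsTest Ω φ) (hψ : IsTest Ω ψ) :
    IsTest Ω (φ + ψ) :=
  ⟨hφ.contDiff.add hψ.contDiff, hφ.hasCompactSupport.add hψ.hasCompactSupport,
    (tsupport_add φ ψ).trans (Set.union_subset hφ.tsupport_subset hψ.tsupport_subset)⟩

theorem IsTest.smul {φ : Space d → ℝ} (c : ℝ) (hφ : IsTest Ω φ) : IsTest Ω (c • φ) :=
  ⟨hφ.contDiff.const_smul c, hφ.hasCompactSupport.mono (Function.support_const_smul_subset c φ),
    (closure_mono (Function.support_const_smul_subset c φ)).trans hφ.tsupport_subset⟩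

theorem IsTest.integrable_mul {φ : Space d → ℝ} (hφ : IsTest Ω φ) (g : L2 Ω) :
    Integrable (fun x => g x * φ x) (volume.restrict Ω) :=
  MemLp.integrable_mul (p := 2) (q := 2) (Lp.memLp g)
    ((hφ.contDiff.continuous.memLp_of_hasCompactSupport hφ.hasCompactSupport).restrict Ω)

theorem IsTest.pderiv {φ : Space d → ℝ} (hφ : IsTest Ω φ) (i : Fin d) :
    IsTest Ω (pderiv i φ) := by
  refine ⟨(hφ.contDiff.fderiv_right (by simp)).clm_apply contDiff_const,
    hφ.hasCompactSupport.fderiv_apply ℝ _, ?_⟩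
  exact (tsupport_fderiv_apply_subset ℝ _).trans hφ.tsupport_subset

theorem IsWeakDeriv.zero (i : Fin d) : IsWeakDeriv Ω i 0 0 := by
  intro φ _
  have h0 : ∀ ψ : Space d → ℝ, ∫ x in Ω, (0 : L2 Ω) x * ψ x = 0 := by
    intro ψ
    refine integral_eq_zero_of_ae ?_
    filter_upwards [Lp.coeFn_zero ℝ 2 (volume.restrict Ω)] with x hx
    rw [hx, Pi.zero_apply, zero_mul]
  rw [h0, h0, neg_zero]

theorem IsWeakDeriv.add {i : Fin d} {g g' w w' : L2 Ω} (h : IsWeakDeriv Ω i g w)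
    (h' : IsWeakDeriv Ω i g' w') : IsWeakDeriv Ω i (g + g') (w + w') := by
  intro φ hφ
  have key : ∀ (p q : L2 Ω) (ψ : Space d → ℝ), IsTest Ω ψ →
      ∫ x in Ω, (p + q) x * ψ x = (∫ x in Ω, p x * ψ x) + ∫ x in Ω, q x * ψ x := by
    intro p q ψ hψ
    rw [← integral_add (hψ.integrable_mul p) (hψ.integrable_mul q)]
    refine integral_congr_ae ?_
    filter_upwards [Lp.coeFn_add p q] with x hx
    rw [hx, Pi.add_apply, add_mul]
  rw [key _ _ _ (hφ.pderiv i), key _ _ _ hφ, h φ hφ, h' φ hφ]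
  ring

theorem IsWeakDeriv.smul {i : Fin d} {g w : L2 Ω} (c : ℝ) (h : IsWeakDeriv Ω i g w) :
    IsWeakDeriv Ω i (c • g) (c • w) := by
  intro φ hφ
  have key : ∀ (p : L2 Ω) (ψ : Space d → ℝ),
      ∫ x in Ω, (c • p) x * ψ x = c * ∫ x in Ω, p x * ψ x := by
    intro p ψ
    rw [← integral_const_mul]
    refine integral_congr_ae ?_
    filter_upwards [Lp.coeFn_smul c p] with x hx
    rw [hx, Pi.smul_apply, smul_eq_mul, mul_assoc]
  rw [key, key, h φ hφ]
  ring

/-- Weak derivatives are unique. -/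
theorem IsWeakDeriv.unique (hΩ : IsOpen Ω) {i : Fin d} {g w w' : L2 Ω}
    (h : IsWeakDeriv Ω i g w) (h' : IsWeakDeriv Ω i g w') : w = w' := by
  have key : ∀ᵐ x, x ∈ Ω → w x - w' x = 0 := by
    refine hΩ.ae_eq_zero_of_integral_contDiff_smul_eq_zero (f := fun x => w x - w' x) ?_ ?_
    · exact locallyIntegrableOn_of_locallyIntegrable_restrict
        (((Lp.memLp w).sub (Lp.memLp w')).locallyIntegrable (by norm_num))
    · intro φ h1 h2 h3
      have hφ : IsTest Ω φ := ⟨h1, h2, h3⟩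
      have e := (h φ hφ).symm.trans (h' φ hφ)
      rw [← setIntegral_eq_integral_of_forall_compl_eq_zero (s := Ω)
        (fun x hx => by rw [image_eq_zero_of_notMem_tsupport (fun hx' => hx (h3 hx')), zero_smul])]
      have e2 := integral_sub (hφ.integrable_mul w) (hφ.integrable_mul w')
      simp only [smul_eq_mul, mul_sub]
      simp only [mul_comm] at e2 e ⊢
      linarith
  refine Lp.ext ((ae_restrict_iff' hΩ.measurableSet).2 ?_)
  filter_upwards [key] with x hx h
  exact sub_eq_zero.1 (hx h)

end Helpers

/-- The test functions as a subspace of `H¹(Ω)`: the pairs `(φ, ∇φ)` with `φ ∈ C_c^∞(Ω)`. -/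
def testJet {d : ℕ} (Ω : Set (Space d)) : Submodule ℝ (Jet1 Ω) where
  carrier := {J | ∃ φ : Space d → ℝ, IsTest Ω φ ∧ J.fst =ᵐ[volume.restrict Ω] φ ∧
    ∀ i, J.snd i =ᵐ[volume.restrict Ω] pderiv i φ}
  zero_mem' := by
    refine ⟨0, IsTest.zero, Lp.coeFn_zero _ _ _, fun i => ?_⟩
    refine (Lp.coeFn_zero ℝ 2 (volume.restrict Ω)).trans (ae_of_all _ fun x => ?_)
    simp [pderiv]
  add_mem' := by
    rintro J K ⟨φ, hφ, h1, h2⟩ ⟨ψ, hψ, k1, k2⟩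
    refine ⟨φ + ψ, hφ.add hψ, ?_, fun i => ?_⟩
    · exact (Lp.coeFn_add J.fst K.fst).trans (h1.add k1)
    · have e : pderiv i (φ + ψ) = pderiv i φ + pderiv i ψ := by
        ext x
        simp only [pderiv, Pi.add_apply]
        rw [fderiv_add (hφ.contDiff.differentiable (by simp) x)
          (hψ.contDiff.differentiable (by simp) x)]
        rfl
      rw [e]
      exact (Lp.coeFn_add (J.snd i) (K.snd i)).trans ((h2 i).add (k2 i))
  smul_mem' := by
    rintro c J ⟨φ, hφ, h1, h2⟩
    refine ⟨c • φ, hφ.smul c, ?_, fun i => ?_⟩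
    · exact (Lp.coeFn_smul c J.fst).trans (h1.const_smul c)
    · have e : pderiv i (c • φ) = c • pderiv i φ := by
        ext x
        simp only [pderiv, Pi.smul_apply]
        rw [fderiv_const_smul (hφ.contDiff.differentiable (by simp) x)]
        rfl
      rw [e]
      exact (Lp.coeFn_smul c (J.snd i)).trans ((h2 i).const_smul c)

/-- `H¹₀(Ω)`: the closure of `C_c^∞(Ω)` in the `H¹`-norm.  An element is stored together with its
(weak) gradient. -/
def H10 {d : ℕ} (Ω : Set (Space d)) : Submodule ℝ (Jet1 Ω) := (testJet Ω).topologicalClosure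

/-- `H²(Ω)`: the functions `v ∈ L²(Ω)` with weak derivatives of first and second order in `L²(Ω)`.
An element is stored together with these derivatives, which `v` determines uniquely (`Ω` being
open), so that the norm induced by `Jet2` is
`‖v‖_{H²}² = ‖v‖² + ∑ᵢ ‖∂ᵢv‖² + ∑ᵢⱼ ‖∂ᵢⱼv‖²`. -/
def H2 {d : ℕ} (Ω : Set (Space d)) : Submodule ℝ (Jet2 Ω) where
  carrier := {J | (∀ i, IsWeakDeriv Ω i J.fst.fst (J.fst.snd i)) ∧
    ∀ i j, IsWeakDeriv Ω j (J.fst.snd i) (J.snd (i, j))}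
  zero_mem' := ⟨fun i => IsWeakDeriv.zero i, fun _ j => IsWeakDeriv.zero j⟩
  add_mem' := fun h k => ⟨fun i => (h.1 i).add (k.1 i), fun i j => (h.2 i j).add (k.2 i j)⟩
  smul_mem' := fun c _ h => ⟨fun i => (h.1 i).smul c, fun i j => (h.2 i j).smul c⟩

/-- `V = H²(Ω) ∩ H¹₀(Ω)`, with the norm and the inner product of `H²(Ω)`. -/
def V {d : ℕ} (Ω : Set (Space d)) : Submodule ℝ (Jet2 Ω) :=
  H2 Ω ⊓ (H10 Ω).comap (WithLp.fstₗ 2 ℝ (Jet1 Ω) (PiLp 2 (fun _ : Fin d × Fin d => L2 Ω)))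

/-- The Hessian `D²v(x)`. -/
def hess {d : ℕ} {Ω : Set (Space d)} (v : V Ω) (x : Space d) : Mat d :=
  fun i j => ((v : Jet2 Ω).snd (i, j)) x

/-! ### The Hamiltonian and its subdifferential -/

section Hamiltonian

variable {d : ℕ} {𝒜 : Type*}

/-- The Hamiltonian `H(x, M) = sup_α { -a(x, α) : M - f(x, α) }`. -/
def ham (a : Space d → 𝒜 → Mat d) (f : Space d → 𝒜 → ℝ) (x : Space d) (M : Mat d) : ℝ :=
  ⨆ α, (-(frob (a x α) M) - f x α)

/-- The partial subdifferential `∂_M H(x, M)`, a set of symmetric matrices. -/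
def subdiff (a : Space d → 𝒜 → Mat d) (f : Space d → 𝒜 → ℝ) (x : Space d) (M : Mat d) :
    Set (Mat d) :=
  {A | A.IsSymm ∧ ∀ M' : Mat d, M'.IsSymm →
    ham a f x M + frob A (M' - M) ≤ ham a f x M'}

/-- The function `H[v](x) = H(x, D²v(x))`. -/
def hamOp (a : Space d → 𝒜 → Mat d) (f : Space d → 𝒜 → ℝ) {Ω : Set (Space d)} (v : V Ω)
    (x : Space d) : ℝ :=
  ham a f x (hess v x)

/-- The value at `x` of a matrix-valued function with components in `L^∞(Ω)`. -/
def matAt {Ω : Set (Space d)} (A : Matrix (Fin d) (Fin d) (LInfty Ω)) (x : Space d) : Mat d :=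
  fun i j => A i j x

/-- `𝒟H[v]`: the measurable (and essentially bounded) selections `A` of
`x ↦ ∂_M H(x, D²v(x))`. -/
def DH (a : Space d → 𝒜 → Mat d) (f : Space d → 𝒜 → ℝ) {Ω : Set (Space d)} (v : V Ω) :
    Set (Matrix (Fin d) (Fin d) (LInfty Ω)) :=
  {A | ∀ᵐ x ∂(volume.restrict Ω), matAt A x ∈ subdiff a f x (hess v x)}

theorem continuousOn_ham [TopologicalSpace 𝒜] [CompactSpace 𝒜]
    {a : Space d → 𝒜 → Mat d} {f : Space d → 𝒜 → ℝ} {K : Set (Space d)}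
    (ha : ContinuousOn (fun p : Space d × 𝒜 => a p.1 p.2) (K ×ˢ Set.univ))
    (hf : ContinuousOn (fun p : Space d × 𝒜 => f p.1 p.2) (K ×ˢ Set.univ)) :
    Continuous (fun p : K × Mat d => ham a f p.1 p.2) := by
  have ha' : Continuous (fun p : (K × Mat d) × 𝒜 => a p.1.1 p.2) :=
    ha.comp_continuous (f := fun p : (K × Mat d) × 𝒜 => ((p.1.1 : Space d), p.2)) (by fun_prop)
      (fun p => ⟨p.1.1.2, Set.mem_univ _⟩)
  have hf' : Continuous (fun p : (K × Mat d) × 𝒜 => f p.1.1 p.2) :=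
    hf.comp_continuous (f := fun p : (K × Mat d) × 𝒜 => ((p.1.1 : Space d), p.2)) (by fun_prop)
      (fun p => ⟨p.1.1.2, Set.mem_univ _⟩)
  have key : Continuous (fun p : (K × Mat d) × 𝒜 => -(frob (a p.1.1 p.2) p.1.2) - f p.1.1 p.2) := by
    unfold frob
    refine (Continuous.neg ?_).sub hf'
    refine continuous_finsetSum _ fun i _ => continuous_finsetSum _ fun j _ => ?_
    exact (ha'.matrix_elem i j).mul ((continuous_snd.comp continuous_fst).matrix_elem i j)
  have := isCompact_univ.continuous_sSup (K := (Set.univ : Set 𝒜))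
    (f := fun (p : K × Mat d) α => -(frob (a p.1 α) p.2) - f p.1 α) key
  simpa [ham, iSup, Set.image_univ] using this

/-- `H[v] ∈ L²(Ω)`, so that the integrals in the variational inequality below converge. -/
theorem memLp_hamOp [TopologicalSpace 𝒜] [CompactSpace 𝒜] [Nonempty 𝒜]
    {a : Space d → 𝒜 → Mat d} {f : Space d → 𝒜 → ℝ} {Ω : Set (Space d)}
    (hΩ : IsOpen Ω) (hb : Bornology.IsBounded Ω)
    (ha : ContinuousOn (fun p : Space d × 𝒜 => a p.1 p.2) (closure Ω ×ˢ Set.univ))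
    (hf : ContinuousOn (fun p : Space d × 𝒜 => f p.1 p.2) (closure Ω ×ˢ Set.univ)) (v : V Ω) :
    MemLp (hamOp a f v) 2 (volume.restrict Ω) := by
  have : IsFiniteMeasure (volume.restrict Ω) := ⟨by simpa using hb.measure_lt_top⟩
  have hcpt : IsCompact (closure Ω ×ˢ (Set.univ : Set 𝒜)) :=
    (hb.isCompact_closure).prod isCompact_univ
  have hh : ∀ i j, MemLp (fun x => hess v x i j) 2 (volume.restrict Ω) :=
    fun i j => Lp.memLp _
  have hm : AEStronglyMeasurable (hamOp a f v) (volume.restrict Ω) := by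
    let : MeasurableSpace (Mat d) := MeasurableSpace.pi
    have : BorelSpace (Mat d) := inferInstanceAs (BorelSpace (Fin d → Fin d → ℝ))
    have : SecondCountableTopology (Mat d) :=
      inferInstanceAs (SecondCountableTopology (Fin d → Fin d → ℝ))
    have hmv : Measurable (hess v) := by
      refine measurable_pi_iff.2 fun i => measurable_pi_iff.2 fun j => ?_
      exact (Lp.stronglyMeasurable _).measurable
    have h1 : Measurable (fun x : Ω => hamOp a f v x) :=
      (continuousOn_ham ha hf).measurable.comp (g := fun p : closure Ω × Mat d => ham a f p.1 p.2)
        (f := fun x : Ω => ((⟨x, subset_closure x.2⟩ : closure Ω), hess v x))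
        (by
          refine Measurable.prodMk (by fun_prop) (hmv.comp measurable_subtype_coe))
    have := (aemeasurable_restrict_iff_comap_subtype (μ := volume) hΩ.measurableSet
      (f := hamOp a f v)).2 h1.aemeasurable
    exact this.aestronglyMeasurable
  obtain ⟨Ca, hCa⟩ : ∃ C, ∀ i j, ∀ x ∈ closure Ω, ∀ α, |a x α i j| ≤ C := by
    have : ∀ i j, ∃ C, ∀ x ∈ closure Ω, ∀ α, |a x α i j| ≤ C := fun i j => by
      obtain ⟨C, hC⟩ := hcpt.exists_bound_of_continuousOn
        (f := fun p : Space d × 𝒜 => a p.1 p.2 i j)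
        (((continuous_id.matrix_elem i j).comp_continuousOn ha))
      exact ⟨C, fun x hx α => hC (x, α) ⟨hx, Set.mem_univ _⟩⟩
    choose C hC using this
    refine ⟨∑ i, ∑ j, |C i j|, fun i j x hx α => (hC i j x hx α).trans ?_⟩
    calc C i j ≤ |C i j| := le_abs_self _
      _ ≤ ∑ j, |C i j| := Finset.single_le_sum (f := fun j => |C i j|) (fun _ _ => abs_nonneg _) (Finset.mem_univ j)
      _ ≤ _ := Finset.single_le_sum (f := fun i => ∑ j, |C i j|)
        (fun _ _ => Finset.sum_nonneg fun _ _ => abs_nonneg _) (Finset.mem_univ i)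
  obtain ⟨Cf, hCf⟩ := hcpt.exists_bound_of_continuousOn hf
  have hdom : MemLp (fun x => (∑ i, ∑ j, Ca * |hess v x i j|) + Cf) 2 (volume.restrict Ω) := by
    refine MemLp.add ?_ (memLp_const Cf)
    refine memLp_finsetSum _ fun i _ => memLp_finsetSum _ fun j _ => ?_
    exact (hh i j).abs.const_mul Ca
  refine hdom.mono' hm ?_
  filter_upwards [ae_restrict_mem hΩ.measurableSet] with x hx
  have hx' := subset_closure hx
  have hpt : ∀ α, |-(frob (a x α) (hess v x)) - f x α| ≤ (∑ i, ∑ j, Ca * |hess v x i j|) + Cf := by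
    intro α
    have h1 : |frob (a x α) (hess v x)| ≤ ∑ i, ∑ j, Ca * |hess v x i j| := by
      unfold frob
      refine (Finset.abs_sum_le_sum_abs _ _).trans (Finset.sum_le_sum fun i _ => ?_)
      refine (Finset.abs_sum_le_sum_abs _ _).trans (Finset.sum_le_sum fun j _ => ?_)
      rw [abs_mul]
      exact mul_le_mul_of_nonneg_right (hCa i j x hx' α) (abs_nonneg _)
    have h2 : |f x α| ≤ Cf := hCf (x, α) ⟨hx', Set.mem_univ _⟩
    rw [abs_le] at *
    constructor <;> linarith [h1.1, h1.2, h2.1, h2.2]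
  rw [Real.norm_eq_abs, abs_le]
  have hbdd : BddAbove (Set.range fun α => -(frob (a x α) (hess v x)) - f x α) :=
    ⟨_, by rintro _ ⟨α, rfl⟩; exact (abs_le.1 (hpt α)).2⟩
  exact ⟨(abs_le.1 (hpt (Classical.arbitrary 𝒜))).1.trans (le_ciSup hbdd _),
    ciSup_le fun α => (abs_le.1 (hpt α)).2⟩

/-! ### The two problems -/

/-- `(u, m)` is a solution of the PDI problem. -/
def IsPDISolution {Ω : Set (Space d)} (a : Space d → 𝒜 → Mat d) (f : Space d → 𝒜 → ℝ)
    (F : L2 Ω → L2 Ω) (G : StrongDual ℝ (V Ω)) (u : V Ω) (m : L2 Ω) : Prop :=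
  ∃ abar : Matrix (Fin d) (Fin d) (LInfty Ω), -abar ∈ DH a f u ∧
    (∀ᵐ x ∂(volume.restrict Ω), hamOp a f u x = F m x) ∧
    ∀ v : V Ω, ∫ x in Ω, m x * frob (matAt (-abar) x) (hess v x) = G v

/-- `(u, m)` is a solution of the VI problem. -/
def IsVISolution {Ω : Set (Space d)} (a : Space d → 𝒜 → Mat d) (f : Space d → 𝒜 → ℝ)
    (F : L2 Ω → L2 Ω) (G : StrongDual ℝ (V Ω)) (u : V Ω) (m : L2 Ω) : Prop :=
  (∀ᵐ x ∂(volume.restrict Ω), 0 ≤ m x) ∧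
    (∀ᵐ x ∂(volume.restrict Ω), hamOp a f u x = F m x) ∧
    ∀ v : V Ω, G (v - u) ≤ ∫ x in Ω, m x * (hamOp a f v x - hamOp a f u x)

end Hamiltonian

end

end MeanFieldGame

/-!
For `m ≥ 0`, a subgradient field `A(x) ∈ ∂_M H(x, D²u(x))` turns the equation for `m` into the
variational inequality: multiply `H[v] - H[u] ≥ A : D²(v - u)` by `m` and integrate
(`IsPDISolution.isVISolution`).  The subdifferential is tested with symmetric matrices only, so this
uses that weak Hessians are symmetric (`hess_isSymm`).

For the converse, write the variational inequality as `⟨G, v⟩ ≤ Φ(D²v)` for all `v ∈ V`, where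
`Φ(Z) = ∫ m (H(·, D²u + Z) - H(·, D²u))` is convex on all of `L²(Ω)^{d × d}`, vanishes at `0`, and
has at most linear growth because `H(x, ·)` is Lipschitz uniformly in `x`.  Hahn–Banach
(`exists_linearMap_le_of_convexOn`) gives a linear `Λ ≤ Φ` on `L²(Ω)^{d × d}` with `Λ(D²v) = ⟨G, v⟩`,
and Riesz a field `B` with `Λ(Z) = ∫ B : Z`.  Testing `Λ ≤ Φ` with constant matrices on measurable
sets makes the bound pointwise (`exists_field_of_le_integral_hamIncr`):
`B(x) : M ≤ m(x) (H(x, D²u(x) + M) - H(x, D²u(x)))` for all `M`, for a.e. `x`.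
So `B / m` is a subgradient where `m > 0`, and `B = 0` where `m = 0`.  On the latter set any measurable
selection of subgradients serves; the same Hahn–Banach argument with weight `1` in place of `m`
provides one (`exists_subgradient_field`).

The matrices `a(x, α)` being symmetric, `H(x, ·)` depends only on the symmetric part of its argument.
Hence everything can be done in the space of all matrix fields, and the matrices obtained are
automatically symmetric (`AdmissibleAt.mem_subdiff`).
-/

namespace MeanFieldGame


/-! ### Extension of linear functionals dominated by a convex function -/

/-- A Hahn–Banach theorem for a convex majorant vanishing at `0`, where the functional is given on
the domain of a linear map `T` instead of on a subspace. -/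
theorem exists_linearMap_le_of_convexOn {W E : Type*} [AddCommGroup W] [Module ℝ W]
    [AddCommGroup E] [Module ℝ E] {Φ : E → ℝ} (hΦ : ConvexOn ℝ Set.univ Φ) (h0 : Φ 0 = 0)
    (T : W →ₗ[ℝ] E) (g : W →ₗ[ℝ] ℝ) (hg : ∀ v, g v ≤ Φ (T v)) :
    ∃ Λ : E →ₗ[ℝ] ℝ, (∀ v, Λ (T v) = g v) ∧ ∀ z, Λ z ≤ Φ z := by
  have conv : ∀ x y : E, ∀ s t : ℝ, 0 ≤ s → 0 ≤ t → s + t = 1 →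
      Φ (s • x + t • y) ≤ s * Φ x + t * Φ y := fun x y s t hs ht hst =>
    hΦ.2 (Set.mem_univ x) (Set.mem_univ y) hs ht hst
  -- The directional derivative of `Φ` at `0`, as an infimum of difference quotients.
  let N : E → ℝ := fun z => ⨅ t : Set.Ioi (0 : ℝ), Φ ((t : ℝ) • z) / t
  have hbdd : ∀ z, BddBelow (Set.range fun t : Set.Ioi (0 : ℝ) => Φ ((t : ℝ) • z) / t) := by
    rintro z
    refine ⟨-Φ (-z), ?_⟩
    rintro _ ⟨⟨t, ht : 0 < t⟩, rfl⟩
    have h1 : 0 < 1 + t := by linarith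
    have h := conv (t • z) (-z) (1 / (1 + t)) (t / (1 + t)) (by positivity) (by positivity)
      (by field_simp)
    have e : (1 / (1 + t)) • t • z + (t / (1 + t)) • -z = 0 := by
      rw [smul_smul, smul_neg, one_div_mul_eq_div, add_neg_cancel]
    rw [e, h0] at h
    have h2 : 0 ≤ Φ (t • z) + t * Φ (-z) := by
      have e2 : 1 / (1 + t) * Φ (t • z) + t / (1 + t) * Φ (-z) =
          (Φ (t • z) + t * Φ (-z)) / (1 + t) := by ring
      rw [e2] at h
      by_contra! hneg
      exact absurd h (not_le.2 (div_neg_of_neg_of_pos hneg h1))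
    change -Φ (-z) ≤ Φ (t • z) / t
    rw [le_div_iff₀ ht]
    linarith
  have N_le : ∀ z (t : ℝ), 0 < t → N z ≤ Φ (t • z) / t := fun z t ht =>
    ciInf_le (hbdd z) ⟨t, ht⟩
  have : Nonempty (Set.Ioi (0 : ℝ)) := ⟨⟨1, Set.mem_Ioi.2 one_pos⟩⟩
  have N_add : ∀ x y, N (x + y) ≤ N x + N y := by
    intro x y
    refine le_ciInf_add_ciInf ?_
    rintro ⟨s, hs : 0 < s⟩ ⟨t, ht : 0 < t⟩
    have hst : 0 < s + t := by linarith
    refine (N_le (x + y) (s * t / (s + t)) (by positivity)).trans ?_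
    have h := conv (s • x) (t • y) (t / (s + t)) (s / (s + t)) (by positivity) (by positivity)
      (by field_simp; ring)
    have e : (t / (s + t)) • s • x + (s / (s + t)) • t • y = (s * t / (s + t)) • (x + y) := by
      rw [smul_add, smul_smul, smul_smul]
      congr 2 <;> ring
    rw [e] at h
    rw [div_le_iff₀ (by positivity)]
    refine h.trans (le_of_eq ?_)
    field_simp
  have N_smul_le : ∀ c : ℝ, 0 < c → ∀ x, N (c • x) ≤ c * N x := by
    intro c hc x
    have : N (c • x) / c ≤ N x := by
      refine le_ciInf ?_
      rintro ⟨t, ht : 0 < t⟩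
      rw [div_le_iff₀ hc]
      refine (N_le _ (t / c) (by positivity)).trans (le_of_eq ?_)
      rw [smul_smul, div_mul_cancel₀ _ hc.ne']
      field_simp
    rw [div_le_iff₀ hc] at this
    linarith
  have N_hom : ∀ c : ℝ, 0 < c → ∀ x, N (c • x) = c * N x := by
    intro c hc x
    refine le_antisymm (N_smul_le c hc x) ?_
    have h := N_smul_le c⁻¹ (by positivity) (c • x)
    rw [smul_smul, inv_mul_cancel₀ hc.ne', one_smul, inv_mul_eq_div, le_div_iff₀ hc] at h
    linarith
  have hgN : ∀ v, g v ≤ N (T v) := by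
    intro v
    refine le_ciInf ?_
    rintro ⟨t, ht : 0 < t⟩
    rw [le_div_iff₀ ht]
    have h := hg (t • v)
    rw [map_smul, map_smul, smul_eq_mul] at h
    linarith
  have hker : g ∈ LinearMap.range T.dualMap := by
    rw [LinearMap.range_dualMap_eq_dualAnnihilator_ker, Submodule.mem_dualAnnihilator]
    intro v hv
    rw [LinearMap.mem_ker] at hv
    have h1 := hg v
    have h2 := hg (-v)
    simp only [map_neg, hv, neg_zero, h0] at h1 h2
    linarith
  obtain ⟨g', rfl⟩ := hker
  obtain ⟨Λ, h1, h2⟩ := exists_extension_of_le_sublinear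
    ⟨LinearMap.range T, g'.domRestrict (LinearMap.range T)⟩ N N_hom N_add (by
      rintro ⟨_, v, rfl⟩
      exact hgN v)
  refine ⟨Λ, fun v => h1 ⟨T v, v, rfl⟩, fun z => (h2 z).trans ?_⟩
  have := N_le z 1 one_pos
  rwa [one_smul, div_one] at this

/-! ### The Frobenius product and the Hamiltonian at a point -/

section Pointwise

variable {d : ℕ} {𝒜 : Type*}

theorem frob_add (A M N : Mat d) : frob A (M + N) = frob A M + frob A N := by
  simp [frob, mul_add, Finset.sum_add_distrib]

theorem frob_smul (c : ℝ) (A M : Mat d) : frob A (c • M) = c * frob A M := by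
  simp only [frob, Matrix.smul_apply, smul_eq_mul, Finset.mul_sum]
  exact Finset.sum_congr rfl fun i _ => Finset.sum_congr rfl fun j _ => by ring

theorem smul_frob (c : ℝ) (A M : Mat d) : frob (c • A) M = c * frob A M := by
  simp only [frob, Matrix.smul_apply, smul_eq_mul, Finset.mul_sum]
  exact Finset.sum_congr rfl fun i _ => Finset.sum_congr rfl fun j _ => by ring

theorem frob_neg (A M : Mat d) : frob A (-M) = -frob A M := by
  rw [← neg_one_smul ℝ, frob_smul, neg_one_mul]

theorem frob_sub (A M N : Mat d) : frob A (M - N) = frob A M - frob A N := by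
  rw [sub_eq_add_neg, frob_add, frob_neg, sub_eq_add_neg]

theorem frob_transpose (A M : Mat d) : frob A M.transpose = frob A.transpose M := by
  simp only [frob, Matrix.transpose_apply]
  exact Finset.sum_comm

theorem frob_single (A : Mat d) (i j : Fin d) (c : ℝ) :
    frob A (Matrix.single i j c) = A i j * c := by
  simp only [frob, Matrix.single_apply, mul_ite, mul_zero]
  rw [Finset.sum_eq_single i, Finset.sum_eq_single j] <;> simp +contextual [eq_comm]

theorem continuous_frob (A : Mat d) : Continuous (frob A) := by
  unfold frob
  fun_prop

/-- The sum of the absolute values of the entries of a matrix. -/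
def absSum (M : Mat d) : ℝ := ∑ i, ∑ j, |M i j|

theorem absSum_neg (M : Mat d) : absSum (-M) = absSum M := by simp [absSum]

theorem absSum_single (i j : Fin d) (c : ℝ) : absSum (Matrix.single i j c) = |c| := by
  simp only [absSum, Matrix.single_apply]
  rw [Finset.sum_eq_single i, Finset.sum_eq_single j] <;> simp +contextual [eq_comm]

theorem abs_frob_le {A : Mat d} {C : ℝ} (hA : ∀ i j, |A i j| ≤ C) (M : Mat d) :
    |frob A M| ≤ C * absSum M := by
  unfold frob absSum
  rw [Finset.mul_sum]
  refine (Finset.abs_sum_le_sum_abs _ _).trans (Finset.sum_le_sum fun i _ => ?_)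
  rw [Finset.mul_sum]
  refine (Finset.abs_sum_le_sum_abs _ _).trans (Finset.sum_le_sum fun j _ => ?_)
  rw [abs_mul]
  exact mul_le_mul_of_nonneg_right (hA i j) (abs_nonneg _)

/-- Values at a single point `x` of data for which the supremum defining `H(x, ·)` is finite, with
coefficients bounded by `C`. -/
structure AdmissibleAt (a : Space d → 𝒜 → Mat d) (f : Space d → 𝒜 → ℝ) (C : ℝ) (x : Space d) :
    Prop where
  symm : ∀ α, (a x α).IsSymm
  abs_coeff_le : ∀ α i j, |a x α i j| ≤ C
  bddBelow : BddBelow (Set.range (f x))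

variable {a : Space d → 𝒜 → Mat d} {f : Space d → 𝒜 → ℝ} {C : ℝ} {x : Space d}

theorem AdmissibleAt.bddAbove (h : AdmissibleAt a f C x) (M : Mat d) :
    BddAbove (Set.range fun α => -(frob (a x α) M) - f x α) := by
  obtain ⟨c, hc⟩ := h.bddBelow
  refine ⟨C * absSum M - c, ?_⟩
  rintro _ ⟨α, rfl⟩
  have h1 := (abs_le.1 (abs_frob_le (h.abs_coeff_le α) M)).1
  have h2 : c ≤ f x α := hc ⟨α, rfl⟩
  change -(frob (a x α) M) - f x α ≤ _
  linarith

theorem AdmissibleAt.le_ham (h : AdmissibleAt a f C x) (M : Mat d) (α : 𝒜) :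
    -(frob (a x α) M) - f x α ≤ ham a f x M :=
  le_ciSup (h.bddAbove M) α

/-- Continuous data on the compact set `closure Ω × 𝒜` are admissible with a uniform bound. -/
theorem exists_admissibleAt [TopologicalSpace 𝒜] [CompactSpace 𝒜] {Ω : Set (Space d)}
    (hb : Bornology.IsBounded Ω)
    (hs : ∀ x ∈ closure Ω, ∀ α, (a x α).IsSymm)
    (ha : ContinuousOn (fun p : Space d × 𝒜 => a p.1 p.2) (closure Ω ×ˢ Set.univ))
    (hf : ContinuousOn (fun p : Space d × 𝒜 => f p.1 p.2) (closure Ω ×ˢ Set.univ)) :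
    ∃ C, 0 ≤ C ∧ ∀ x ∈ closure Ω, AdmissibleAt a f C x := by
  have hcpt : IsCompact (closure Ω ×ˢ (Set.univ : Set 𝒜)) :=
    hb.isCompact_closure.prod isCompact_univ
  have : ∀ i j, ∃ C, ∀ x ∈ closure Ω, ∀ α, |a x α i j| ≤ C := fun i j => by
    obtain ⟨C, hC⟩ := hcpt.exists_bound_of_continuousOn
      (f := fun p : Space d × 𝒜 => a p.1 p.2 i j)
      (((continuous_id.matrix_elem i j).comp_continuousOn ha))
    exact ⟨C, fun x hx α => hC (x, α) ⟨hx, Set.mem_univ _⟩⟩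
  choose C hC using this
  obtain ⟨Cf, hCf⟩ := hcpt.exists_bound_of_continuousOn hf
  refine ⟨∑ i, ∑ j, |C i j|, by positivity, fun x hx => ⟨hs x hx, fun α i j => ?_, -Cf, ?_⟩⟩
  · calc |a x α i j| ≤ C i j := hC i j x hx α
      _ ≤ |C i j| := le_abs_self _
      _ ≤ ∑ j, |C i j| := Finset.single_le_sum (f := fun j => |C i j|)
          (fun _ _ => abs_nonneg _) (Finset.mem_univ j)
      _ ≤ _ := Finset.single_le_sum (f := fun i => ∑ j, |C i j|)
          (fun _ _ => Finset.sum_nonneg fun _ _ => abs_nonneg _) (Finset.mem_univ i)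
  · rintro _ ⟨α, rfl⟩
    exact (abs_le.1 (hCf (x, α) ⟨hx, Set.mem_univ _⟩)).1

/-- The Hamiltonian sees only the symmetric part of its argument. -/
theorem AdmissibleAt.ham_add_of_transpose_eq_neg (h : AdmissibleAt a f C x) (M : Mat d) {Z : Mat d}
    (hZ : Z.transpose = -Z) : ham a f x (M + Z) = ham a f x M := by
  unfold ham
  refine congrArg _ (funext fun α => ?_)
  have h1 := frob_transpose (a x α) Z
  rw [hZ, (h.symm α).eq, frob_neg] at h1
  rw [frob_add, show frob (a x α) Z = 0 by linarith, add_zero]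

variable [Nonempty 𝒜]

theorem AdmissibleAt.ham_add_le (h : AdmissibleAt a f C x) (M Z : Mat d) :
    ham a f x (M + Z) ≤ ham a f x M + C * absSum Z := by
  refine ciSup_le fun α => ?_
  have h1 := (abs_le.1 (abs_frob_le (h.abs_coeff_le α) Z)).1
  have h2 := h.le_ham M α
  rw [frob_add]
  linarith

theorem AdmissibleAt.abs_ham_sub_le (h : AdmissibleAt a f C x) (M Z : Mat d) :
    |ham a f x (M + Z) - ham a f x M| ≤ C * absSum Z := by
  have h1 := h.ham_add_le M Z
  have h2 := h.ham_add_le (M + Z) (-Z)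
  rw [add_neg_cancel_right, absSum_neg] at h2
  rw [abs_le]
  constructor <;> linarith

theorem AdmissibleAt.ham_convex (h : AdmissibleAt a f C x) (M N : Mat d) {s t : ℝ} (hs : 0 ≤ s)
    (ht : 0 ≤ t) (hst : s + t = 1) :
    ham a f x (s • M + t • N) ≤ s * ham a f x M + t * ham a f x N := by
  refine ciSup_le fun α => ?_
  have h1 := mul_le_mul_of_nonneg_left (h.le_ham M α) hs
  have h2 := mul_le_mul_of_nonneg_left (h.le_ham N α) ht
  rw [frob_add, frob_smul, frob_smul]
  have e : f x α = s * f x α + t * f x α := by rw [← add_mul, hst, one_mul]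
  linarith

theorem AdmissibleAt.continuous_ham (h : AdmissibleAt a f C x) : Continuous (ham a f x) := by
  refine continuous_iff_continuousAt.2 fun M => ?_
  refine tendsto_iff_dist_tendsto_zero.2 ?_
  refine squeeze_zero (fun _ => dist_nonneg) (g := fun N => C * absSum (N - M)) (fun N => ?_) ?_
  · rw [Real.dist_eq]
    simpa using h.abs_ham_sub_le M (N - M)
  · have : Continuous fun N : Mat d => C * absSum (N - M) := by
      unfold absSum
      fun_prop
    simpa [absSum] using this.tendsto M

/-- A matrix whose pairing with every increment `Z` is at most the increment of `H(x, ·)` at `M` is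
a subgradient, and its entries are bounded by `C`: symmetry comes from testing with antisymmetric
`Z`, along which `H(x, ·)` is constant. -/
theorem AdmissibleAt.mem_subdiff (h : AdmissibleAt a f C x) {A M : Mat d}
    (hA : ∀ Z, frob A Z ≤ ham a f x (M + Z) - ham a f x M) :
    A ∈ subdiff a f x M ∧ ∀ i j, |A i j| ≤ C := by
  refine ⟨⟨?_, fun M' _ => ?_⟩, fun i j => ?_⟩
  · ext i j
    have key : ∀ i j, A i j ≤ A j i := by
      intro i j
      have h1 := hA (Matrix.single i j 1 - Matrix.single j i 1)
      rw [h.ham_add_of_transpose_eq_neg M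
        (by simp), sub_self, frob_sub, frob_single, frob_single] at h1
      linarith
    exact le_antisymm (key _ _) (key _ _)
  · have h1 := hA (M' - M)
    rw [add_sub_cancel] at h1
    linarith
  · have h1 := fun c => (hA (Matrix.single i j c)).trans (le_of_abs_le (h.abs_ham_sub_le M _))
    simp only [frob_single, absSum_single] at h1
    have h2 := h1 1
    have h3 := h1 (-1)
    rw [abs_neg, abs_one] at h3
    rw [abs_one] at h2
    exact abs_le.2 ⟨by linarith, by linarith⟩

end Pointwise

/-! ### Symmetry of the weak Hessian -/

section Hessian

variable {d : ℕ} {Ω : Set (Space d)}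

theorem IsTest.pderiv_comm {φ : Space d → ℝ} (hφ : IsTest Ω φ) (i j : Fin d) :
    MeanFieldGame.pderiv i (MeanFieldGame.pderiv j φ) =
      MeanFieldGame.pderiv j (MeanFieldGame.pderiv i φ) := by
  have key : ∀ (i j : Fin d) (x : Space d),
      MeanFieldGame.pderiv i (MeanFieldGame.pderiv j φ) x =
        fderiv ℝ (fderiv ℝ φ) x (EuclideanSpace.single i 1) (EuclideanSpace.single j 1) := by
    intro i j x
    have hd : DifferentiableAt ℝ (fderiv ℝ φ) x :=
      (hφ.contDiff.fderiv_right (m := 1) (by norm_cast)).differentiable (by simp) x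
    have e : MeanFieldGame.pderiv j φ = fun y => fderiv ℝ φ y (EuclideanSpace.single j 1) := rfl
    rw [e, MeanFieldGame.pderiv, fderiv_clm_apply hd (differentiableAt_const _)]
    simp
  ext x
  rw [key, key]
  exact (hφ.contDiff.contDiffAt.isSymmSndFDerivAt (by simp; norm_cast)).eq _ _

theorem V.snd_comm (hΩ : IsOpen Ω) (v : V Ω) (i j : Fin d) :
    (v : Jet2 Ω).snd (i, j) = (v : Jet2 Ω).snd (j, i) := by
  have hv := v.2.1
  refine IsWeakDeriv.unique hΩ (hv.2 i j) fun φ hφ => ?_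
  have h1 := hv.1 i _ (hφ.pderiv j)
  have h2 := hv.1 j _ (hφ.pderiv i)
  have h3 := hv.2 j i φ hφ
  rw [hφ.pderiv_comm i j] at h1
  linarith

theorem hess_isSymm (hΩ : IsOpen Ω) (v : V Ω) (x : Space d) : (hess v x).IsSymm := by
  ext i j
  simp only [hess, Matrix.transpose_apply]
  rw [V.snd_comm hΩ v j i]

end Hessian


/-! ### Square-integrable matrix fields -/

section Fields

variable {d : ℕ} {Ω : Set (Space d)}

/-- The Hilbert space `L²(Ω)^{d × d}`, in which the Hessians of the elements of `V` lie. -/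
abbrev MatField (Ω : Set (Space d)) : Type := PiLp 2 (fun _ : Fin d × Fin d => L2 Ω)

/-- The value at `x` of a square-integrable matrix field. -/
noncomputable def fieldAt (Z : MatField Ω) (x : Space d) : Mat d := fun i j => Z (i, j) x

theorem fieldAt_add (Y Z : MatField Ω) :
    ∀ᵐ x ∂(volume.restrict Ω), fieldAt (Y + Z) x = fieldAt Y x + fieldAt Z x := by
  filter_upwards [ae_all_iff.2 fun p => Lp.coeFn_add (Y p) (Z p)] with x hx
  ext i j
  exact hx (i, j)

theorem fieldAt_smul (c : ℝ) (Z : MatField Ω) :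
    ∀ᵐ x ∂(volume.restrict Ω), fieldAt (c • Z) x = c • fieldAt Z x := by
  filter_upwards [ae_all_iff.2 fun p => Lp.coeFn_smul c (Z p)] with x hx
  ext i j
  exact hx (i, j)

theorem fieldAt_zero : ∀ᵐ x ∂(volume.restrict Ω), fieldAt (0 : MatField Ω) x = 0 := by
  filter_upwards [Lp.coeFn_zero ℝ 2 (volume.restrict Ω)] with x hx
  ext i j
  exact hx

theorem measurable_fieldAt (Z : MatField Ω) (i j : Fin d) : Measurable fun x => fieldAt Z x i j :=
  (Lp.stronglyMeasurable (Z (i, j))).measurable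

theorem memLp_fieldAt (Z : MatField Ω) (i j : Fin d) :
    MemLp (fun x => fieldAt Z x i j) 2 (volume.restrict Ω) :=
  Lp.memLp (Z (i, j))

theorem integrable_frob_fieldAt (B Z : MatField Ω) :
    Integrable (fun x => frob (fieldAt B x) (fieldAt Z x)) (volume.restrict Ω) := by
  unfold frob
  exact integrable_finsetSum _ fun i _ => integrable_finsetSum _ fun j _ =>
    MemLp.integrable_mul (p := 2) (q := 2) (memLp_fieldAt B i j) (memLp_fieldAt Z i j)

theorem inner_eq_integral_frob (B Z : MatField Ω) :
    inner ℝ B Z = ∫ x in Ω, frob (fieldAt B x) (fieldAt Z x) := by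
  have hi : ∀ i j, Integrable (fun x => fieldAt B x i j * fieldAt Z x i j)
      (volume.restrict Ω) := fun i j =>
    MemLp.integrable_mul (p := 2) (q := 2) (memLp_fieldAt B i j) (memLp_fieldAt Z i j)
  unfold frob
  rw [PiLp.inner_apply, Fintype.sum_prod_type,
    integral_finsetSum _ fun i _ => integrable_finsetSum _ fun j _ => hi i j]
  refine Finset.sum_congr rfl fun i _ => ?_
  rw [integral_finsetSum _ fun j _ => hi i j]
  refine Finset.sum_congr rfl fun j _ => ?_
  rw [L2.inner_def]
  refine integral_congr_ae (ae_of_all _ fun x => ?_)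
  simp [fieldAt, mul_comm]

theorem memLp_absSum_fieldAt (Z : MatField Ω) :
    MemLp (fun x => absSum (fieldAt Z x)) 2 (volume.restrict Ω) := by
  unfold absSum
  exact memLp_finsetSum _ fun i _ => memLp_finsetSum _ fun j _ => (memLp_fieldAt Z i j).abs

theorem integral_mul_absSum_le (w : L2 Ω) (Z : MatField Ω) :
    ∫ x in Ω, w x * absSum (fieldAt Z x) ≤ (d * d * ‖w‖) * ‖Z‖ := by
  have hi : ∀ i j, Integrable (fun x => w x * |fieldAt Z x i j|) (volume.restrict Ω) := fun i j =>
    MemLp.integrable_mul (p := 2) (q := 2) (Lp.memLp w) (memLp_fieldAt Z i j).abs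
  have hij : ∀ i j, ∫ x in Ω, w x * |fieldAt Z x i j| ≤ ‖w‖ * ‖Z‖ := by
    intro i j
    have h1 : ∫ x in Ω, w x * |fieldAt Z x i j| = inner ℝ |Z (i, j)| w := by
      rw [L2.inner_def]
      refine integral_congr_ae ?_
      filter_upwards [Lp.coeFn_abs (Z (i, j))] with x hx
      simp [hx, fieldAt]
    rw [h1]
    refine (real_inner_le_norm _ _).trans ?_
    rw [mul_comm, norm_abs_eq_norm]
    exact mul_le_mul_of_nonneg_left (PiLp.norm_apply_le Z (i, j)) (norm_nonneg _)
  have e : ∫ x in Ω, w x * absSum (fieldAt Z x) =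
      ∑ i, ∑ j, ∫ x in Ω, w x * |fieldAt Z x i j| := by
    simp only [absSum, Finset.mul_sum]
    rw [integral_finsetSum _ fun i _ => integrable_finsetSum _ fun j _ => hi i j]
    exact Finset.sum_congr rfl fun i _ => integral_finsetSum _ fun j _ => hi i j
  rw [e]
  calc ∑ i, ∑ j, ∫ x in Ω, w x * |fieldAt Z x i j|
      ≤ ∑ _i : Fin d, ∑ _j : Fin d, ‖w‖ * ‖Z‖ :=
        Finset.sum_le_sum fun i _ => Finset.sum_le_sum fun j _ => hij i j
    _ = _ := by simp; ring

/-- The matrix field equal to `M` on `s` and to `0` elsewhere. -/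
noncomputable def indicatorField [IsFiniteMeasure (volume.restrict Ω)] (s : Set (Space d))
    (hs : MeasurableSet s) (M : Mat d) : MatField Ω :=
  WithLp.toLp 2 fun p => indicatorConstLp 2 hs (measure_ne_top _ _) (M p.1 p.2)

theorem fieldAt_indicatorField [IsFiniteMeasure (volume.restrict Ω)] {s : Set (Space d)}
    (hs : MeasurableSet s) (M : Mat d) :
    ∀ᵐ x ∂(volume.restrict Ω), fieldAt (indicatorField (Ω := Ω) s hs M) x =
      s.indicator (fun _ => M) x := by
  have h : ∀ p : Fin d × Fin d, ∀ᵐ x ∂(volume.restrict Ω),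
      (indicatorField (Ω := Ω) s hs M p) x = s.indicator (fun _ => M p.1 p.2) x :=
    fun p => indicatorConstLp_coeFn (hs := hs) (hμs := measure_ne_top _ _)
  filter_upwards [ae_all_iff.2 h] with x hx
  ext i j
  refine (hx (i, j)).trans ?_
  by_cases h : x ∈ s <;> simp [h]

end Fields

/-! ### Increments of the Hamiltonian along matrix fields -/

section Increments

variable {d : ℕ} {Ω : Set (Space d)} {𝒜 : Type*} {a : Space d → 𝒜 → Mat d}
  {f : Space d → 𝒜 → ℝ} {C : ℝ}

theorem aestronglyMeasurable_ham [TopologicalSpace 𝒜] [CompactSpace 𝒜] (hΩ : IsOpen Ω)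
    (ha : ContinuousOn (fun p : Space d × 𝒜 => a p.1 p.2) (closure Ω ×ˢ Set.univ))
    (hf : ContinuousOn (fun p : Space d × 𝒜 => f p.1 p.2) (closure Ω ×ˢ Set.univ))
    {M : Space d → Mat d} (hM : ∀ i j, Measurable fun x => M x i j) :
    AEStronglyMeasurable (fun x => ham a f x (M x)) (volume.restrict Ω) := by
  let : MeasurableSpace (Mat d) := MeasurableSpace.pi
  have : BorelSpace (Mat d) := inferInstanceAs (BorelSpace (Fin d → Fin d → ℝ))
  have : SecondCountableTopology (Mat d) :=
    inferInstanceAs (SecondCountableTopology (Fin d → Fin d → ℝ))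
  have hm : Measurable M := measurable_pi_iff.2 fun i => measurable_pi_iff.2 fun j => hM i j
  have h1 : Measurable (fun x : Ω => ham a f x (M x)) :=
    (continuousOn_ham ha hf).measurable.comp (g := fun p : closure Ω × Mat d => ham a f p.1 p.2)
      (f := fun x : Ω => ((⟨x, subset_closure x.2⟩ : closure Ω), M x))
      (Measurable.prodMk (by fun_prop) (hm.comp measurable_subtype_coe))
  exact ((aemeasurable_restrict_iff_comap_subtype (μ := volume) hΩ.measurableSet
    (f := fun x => ham a f x (M x))).2 h1.aemeasurable).aestronglyMeasurable

/-- The increment `H(x, U(x) + Z(x)) - H(x, U(x))`. -/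
noncomputable def hamIncr (a : Space d → 𝒜 → Mat d) (f : Space d → 𝒜 → ℝ) (U Z : MatField Ω) (x : Space d) : ℝ :=
  ham a f x (fieldAt U x + fieldAt Z x) - ham a f x (fieldAt U x)

variable [TopologicalSpace 𝒜] [CompactSpace 𝒜] [Nonempty 𝒜]

theorem memLp_hamIncr (hΩ : IsOpen Ω)
    (ha : ContinuousOn (fun p : Space d × 𝒜 => a p.1 p.2) (closure Ω ×ˢ Set.univ))
    (hf : ContinuousOn (fun p : Space d × 𝒜 => f p.1 p.2) (closure Ω ×ˢ Set.univ))
    (hC : ∀ x ∈ closure Ω, AdmissibleAt a f C x) (U Z : MatField Ω) :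
    MemLp (hamIncr a f U Z) 2 (volume.restrict Ω) := by
  refine ((memLp_absSum_fieldAt Z).const_mul C).mono' ?_ ?_
  · exact (aestronglyMeasurable_ham hΩ ha hf fun i j =>
      (measurable_fieldAt U i j).add (measurable_fieldAt Z i j)).sub
      (aestronglyMeasurable_ham hΩ ha hf (measurable_fieldAt U))
  · filter_upwards [ae_restrict_mem hΩ.measurableSet] with x hx
    exact (hC x (subset_closure hx)).abs_ham_sub_le _ _

/-- A linear functional dominated by the weighted increment `∫ w (H(·, U + Z) - H(·, U))` extends
from the range of `T` to all of `L²(Ω)^{d × d}` with the same bound; the extension is represented by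
a field `B` by Riesz, and testing with fields supported in small sets localizes the bound to one
for almost every `x`.  Where `w(x) > 0`, that bound says that `B(x) / w(x)` is a subgradient of
`H(x, ·)` at `U(x)`; where `w(x) = 0`, it forces `B(x) = 0`. -/
theorem exists_field_of_le_integral_hamIncr (hΩ : IsOpen Ω) (hb : Bornology.IsBounded Ω)
    (ha : ContinuousOn (fun p : Space d × 𝒜 => a p.1 p.2) (closure Ω ×ˢ Set.univ))
    (hf : ContinuousOn (fun p : Space d × 𝒜 => f p.1 p.2) (closure Ω ×ˢ Set.univ))
    (hC0 : 0 ≤ C) (hC : ∀ x ∈ closure Ω, AdmissibleAt a f C x) (U : MatField Ω)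
    (w : L2 Ω) (hw : ∀ᵐ x ∂(volume.restrict Ω), 0 ≤ w x)
    {W : Type*} [AddCommGroup W] [Module ℝ W] (T : W →ₗ[ℝ] MatField Ω) (g : W →ₗ[ℝ] ℝ)
    (hg : ∀ v, g v ≤ ∫ x in Ω, w x * hamIncr a f U (T v) x) :
    ∃ B : MatField Ω, (∀ v, ∫ x in Ω, frob (fieldAt B x) (fieldAt (T v) x) = g v) ∧
      ∀ᵐ x ∂(volume.restrict Ω), ∀ M : Mat d,
        frob (fieldAt B x) M ≤ w x * (ham a f x (fieldAt U x + M) - ham a f x (fieldAt U x)) := by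
  have hfin : IsFiniteMeasure (volume.restrict Ω) := ⟨by simpa using hb.measure_lt_top⟩
  have hmem : ∀ᵐ x ∂(volume.restrict Ω), AdmissibleAt a f C x := by
    filter_upwards [ae_restrict_mem hΩ.measurableSet] with x hx using hC x (subset_closure hx)
  have hint : ∀ Z : MatField Ω, Integrable (fun x => w x * hamIncr a f U Z x)
      (volume.restrict Ω) := fun Z =>
    MemLp.integrable_mul (p := 2) (q := 2) (Lp.memLp w) (memLp_hamIncr hΩ ha hf hC U Z)
  let Φ : MatField Ω → ℝ := fun Z => ∫ x in Ω, w x * hamIncr a f U Z x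
  have hΦ0 : Φ 0 = 0 := by
    refine integral_eq_zero_of_ae ?_
    filter_upwards [fieldAt_zero (Ω := Ω)] with x hx
    simp [hamIncr, hx]
  have hΦ : ConvexOn ℝ Set.univ Φ := by
    refine ⟨convex_univ, fun Y _ Z _ s t hs ht hst => ?_⟩
    simp only [Φ, smul_eq_mul]
    rw [← integral_const_mul, ← integral_const_mul,
      ← integral_add ((hint Y).const_mul s) ((hint Z).const_mul t)]
    refine integral_mono_ae (hint _) (((hint Y).const_mul s).add ((hint Z).const_mul t)) ?_
    filter_upwards [hmem, hw, fieldAt_add (s • Y) (t • Z), fieldAt_smul s Y, fieldAt_smul t Z]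
      with x hx hwx e1 e2 e3
    have h := hx.ham_convex (fieldAt U x + fieldAt Y x) (fieldAt U x + fieldAt Z x) hs ht hst
    have e : s • (fieldAt U x + fieldAt Y x) + t • (fieldAt U x + fieldAt Z x) =
        fieldAt U x + fieldAt (s • Y + t • Z) x := by
      rw [e1, e2, e3, smul_add, smul_add, add_add_add_comm, ← add_smul, hst, one_smul]
    rw [e] at h
    have e4 : ham a f x (fieldAt U x) =
        s * ham a f x (fieldAt U x) + t * ham a f x (fieldAt U x) := by
      rw [← add_mul, hst, one_mul]
    have h2 : hamIncr a f U (s • Y + t • Z) x ≤ s * hamIncr a f U Y x + t * hamIncr a f U Z x := by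
      simp only [hamIncr]
      linarith
    calc w x * hamIncr a f U (s • Y + t • Z) x
        ≤ w x * (s * hamIncr a f U Y x + t * hamIncr a f U Z x) :=
          mul_le_mul_of_nonneg_left h2 hwx
      _ = s * (w x * hamIncr a f U Y x) + t * (w x * hamIncr a f U Z x) := by ring
  obtain ⟨Λ, hΛT, hΛ⟩ := exists_linearMap_le_of_convexOn hΦ hΦ0 T g hg
  have hΛle : ∀ Z, Λ Z ≤ C * (d * d * ‖w‖) * ‖Z‖ := by
    intro Z
    refine (hΛ Z).trans ?_
    have h1 : Φ Z ≤ ∫ x in Ω, C * (w x * absSum (fieldAt Z x)) := by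
      refine integral_mono_ae (hint Z) ((MemLp.integrable_mul (p := 2) (q := 2) (Lp.memLp w)
        (memLp_absSum_fieldAt Z)).const_mul C) ?_
      filter_upwards [hmem, hw] with x hx hwx
      have := mul_le_mul_of_nonneg_left
        (le_of_abs_le (hx.abs_ham_sub_le (fieldAt U x) (fieldAt Z x))) hwx
      simp only [hamIncr]
      linarith
    rw [integral_const_mul] at h1
    refine h1.trans ?_
    rw [mul_assoc]
    exact mul_le_mul_of_nonneg_left (integral_mul_absSum_le w Z) hC0
  have hbound : ∀ Z, ‖Λ Z‖ ≤ C * (d * d * ‖w‖) * ‖Z‖ := by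
    intro Z
    rw [Real.norm_eq_abs, abs_le]
    have h1 := hΛle (-Z)
    rw [map_neg, norm_neg] at h1
    exact ⟨by linarith, hΛle Z⟩
  let B : MatField Ω :=
    (InnerProductSpace.toDual ℝ (MatField Ω)).symm (Λ.mkContinuous _ hbound)
  have hB : ∀ Z, ∫ x in Ω, frob (fieldAt B x) (fieldAt Z x) = Λ Z := by
    intro Z
    rw [← inner_eq_integral_frob, InnerProductSpace.toDual_symm_apply]
    rfl
  refine ⟨B, fun v => (hB _).trans (hΛT v), ?_⟩
  have hconst : ∀ M : Mat d, ∀ᵐ x ∂(volume.restrict Ω),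
      frob (fieldAt B x) M ≤ w x * (ham a f x (fieldAt U x + M) - ham a f x (fieldAt U x)) := by
    intro M
    have hM := fieldAt_indicatorField (Ω := Ω) MeasurableSet.univ M
    simp only [Set.indicator_univ] at hM
    refine ae_le_of_forall_setIntegral_le ?_ ?_ fun s hs _ => ?_
    · refine (integrable_frob_fieldAt B (indicatorField Set.univ .univ M)).congr ?_
      filter_upwards [hM] with x hx
      rw [hx]
    · refine (hint (indicatorField Set.univ .univ M)).congr ?_
      filter_upwards [hM] with x hx
      rw [hamIncr, hx]
    · have h := hΛ (indicatorField s hs M)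
      rw [← hB] at h
      have hs' := fieldAt_indicatorField (Ω := Ω) hs M
      rw [← integral_indicator hs, ← integral_indicator hs]
      refine (le_of_eq (integral_congr_ae ?_)).trans
        (h.trans (le_of_eq (integral_congr_ae ?_)))
      · filter_upwards [hs'] with x hx
        rw [hx]
        by_cases hxs : x ∈ s
        · simp [hxs]
        · simp [hxs, frob]
      · filter_upwards [hs'] with x hx
        rw [hamIncr, hx]
        by_cases hxs : x ∈ s <;> simp [hxs]
  have : TopologicalSpace.SeparableSpace (Mat d) :=
    inferInstanceAs (TopologicalSpace.SeparableSpace (Fin d → Fin d → ℝ))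
  filter_upwards [hmem, ae_all_iff.2 fun n => hconst (TopologicalSpace.denseSeq (Mat d) n)]
    with x hx hn M
  have hcl : IsClosed {M : Mat d | frob (fieldAt B x) M ≤
      w x * (ham a f x (fieldAt U x + M) - ham a f x (fieldAt U x))} :=
    isClosed_le (continuous_frob _) (continuous_const.mul
      ((hx.continuous_ham.comp (continuous_const.add continuous_id)).sub continuous_const))
  exact hcl.closure_subset_iff.2 (Set.range_subset_iff.2 hn)
    (TopologicalSpace.denseRange_denseSeq (Mat d) M)

/-- The case `w = 1`, `T = 0` yields a measurable selection of subgradients without any selection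
theorem. -/
theorem exists_subgradient_field (hΩ : IsOpen Ω) (hb : Bornology.IsBounded Ω)
    (ha : ContinuousOn (fun p : Space d × 𝒜 => a p.1 p.2) (closure Ω ×ˢ Set.univ))
    (hf : ContinuousOn (fun p : Space d × 𝒜 => f p.1 p.2) (closure Ω ×ˢ Set.univ))
    (hC0 : 0 ≤ C) (hC : ∀ x ∈ closure Ω, AdmissibleAt a f C x) (U : MatField Ω) :
    ∃ B : MatField Ω, ∀ᵐ x ∂(volume.restrict Ω), ∀ M : Mat d,
      frob (fieldAt B x) M ≤ ham a f x (fieldAt U x + M) - ham a f x (fieldAt U x) := by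
  have hfin : IsFiniteMeasure (volume.restrict Ω) := ⟨by simpa using hb.measure_lt_top⟩
  have hone : ∀ᵐ x ∂(volume.restrict Ω), indicatorConstLp 2 (μ := volume.restrict Ω)
      MeasurableSet.univ (measure_ne_top _ _) (1 : ℝ) x = 1 := by
    filter_upwards [indicatorConstLp_coeFn (p := 2) (μ := volume.restrict Ω)
      (hs := MeasurableSet.univ) (hμs := measure_ne_top _ _) (c := (1 : ℝ))] with x hx
    rw [hx, Set.indicator_univ]
  obtain ⟨B, -, hB⟩ := exists_field_of_le_integral_hamIncr hΩ hb ha hf hC0 hC U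
    (indicatorConstLp 2 MeasurableSet.univ (measure_ne_top _ _) 1)
    (hone.mono fun x hx => zero_le_one.trans_eq hx.symm) (0 : ℝ →ₗ[ℝ] MatField Ω) 0 (fun v => by
      refine ge_of_eq (integral_eq_zero_of_ae ?_)
      filter_upwards [fieldAt_zero (Ω := Ω)] with x hx
      simp [hamIncr, hx])
  refine ⟨B, ?_⟩
  filter_upwards [hB, hone] with x hx h1
  simp only [h1, one_mul] at hx
  exact hx

end Increments


/-! ### The two implications -/

section Solutions

variable {d : ℕ} {Ω : Set (Space d)} {𝒜 : Type*} {a : Space d → 𝒜 → Mat d}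
  {f : Space d → 𝒜 → ℝ}

theorem integrable_mul_frob_matAt_hess (m : L2 Ω) (A : Matrix (Fin d) (Fin d) (LInfty Ω))
    (v : V Ω) :
    Integrable (fun x => m x * frob (matAt A x) (hess v x)) (volume.restrict Ω) := by
  have h : MemLp (fun x => frob (matAt A x) (hess v x)) 2 (volume.restrict Ω) := by
    unfold frob
    exact memLp_finsetSum _ fun i _ => memLp_finsetSum _ fun j _ =>
      MemLp.mul' (p := ∞) (q := 2) (Lp.memLp ((v : Jet2 Ω).snd (i, j))) (Lp.memLp (A i j))
  exact MemLp.integrable_mul (p := 2) (q := 2) (Lp.memLp m) h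

theorem hess_eq_fieldAt (v : V Ω) (x : Space d) : hess v x = fieldAt (v : Jet2 Ω).snd x := rfl

variable [TopologicalSpace 𝒜] [CompactSpace 𝒜] [Nonempty 𝒜] {F : L2 Ω → L2 Ω}
  {G : StrongDual ℝ (V Ω)} {u : V Ω} {m : L2 Ω}

/-- Multiply the subgradient inequality at `D²u(x)` by `m(x) ≥ 0` and integrate. -/
theorem IsPDISolution.isVISolution (hΩ : IsOpen Ω) (hb : Bornology.IsBounded Ω)
    (ha : ContinuousOn (fun p : Space d × 𝒜 => a p.1 p.2) (closure Ω ×ˢ Set.univ))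
    (hf : ContinuousOn (fun p : Space d × 𝒜 => f p.1 p.2) (closure Ω ×ˢ Set.univ))
    (h : IsPDISolution a f F G u m) (hm : ∀ᵐ x ∂(volume.restrict Ω), 0 ≤ m x) :
    IsVISolution a f F G u m := by
  obtain ⟨abar, hA, hu, hG⟩ := h
  refine ⟨hm, hu, fun v => ?_⟩
  rw [← hG]
  refine integral_mono_ae (integrable_mul_frob_matAt_hess m _ _) (MemLp.integrable_mul (p := 2)
    (q := 2) (Lp.memLp m) ((memLp_hamOp hΩ hb ha hf v).sub (memLp_hamOp hΩ hb ha hf u))) ?_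
  have hsub : ∀ᵐ x ∂(volume.restrict Ω), hess (v - u) x = hess v x - hess u x := by
    filter_upwards [fieldAt_add (v - u : V Ω).1.snd (u : Jet2 Ω).snd] with x hx
    have e : (v - u : V Ω).1.snd + (u : Jet2 Ω).snd = (v : Jet2 Ω).snd := by simp
    rw [e] at hx
    simp only [hess_eq_fieldAt]
    rw [hx, add_sub_cancel_right]
  filter_upwards [hA, hm, hsub] with x hx hmx e
  refine mul_le_mul_of_nonneg_left ?_ hmx
  have h1 := hx.2 (hess v x) (hess_isSymm hΩ v x)
  rw [e]
  simp only [hamOp]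
  linarith

/-- The functional `D²v ↦ ⟨G, v⟩` is dominated by the weighted increment of `H`, hence is represented
by a field `B`.  The coefficient is `B / m` where `m > 0`; where `m = 0` any measurable selection of
subgradients will do, since `B = 0` there. -/
theorem IsVISolution.isPDISolution (hΩ : IsOpen Ω) (hb : Bornology.IsBounded Ω)
    (hs : ∀ x ∈ closure Ω, ∀ α, (a x α).IsSymm)
    (ha : ContinuousOn (fun p : Space d × 𝒜 => a p.1 p.2) (closure Ω ×ˢ Set.univ))
    (hf : ContinuousOn (fun p : Space d × 𝒜 => f p.1 p.2) (closure Ω ×ˢ Set.univ))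
    (h : IsVISolution a f F G u m) : IsPDISolution a f F G u m := by
  obtain ⟨hm, hu, hG⟩ := h
  obtain ⟨C, hC0, hC⟩ := exists_admissibleAt hb hs ha hf
  let U : MatField Ω := (u : Jet2 Ω).snd
  let T : V Ω →ₗ[ℝ] MatField Ω := (WithLp.sndₗ 2 ℝ (Jet1 Ω) (MatField Ω)).comp (V Ω).subtype
  obtain ⟨B, hBG, hB⟩ := exists_field_of_le_integral_hamIncr hΩ hb ha hf hC0 hC U m hm T
    (G : V Ω →ₗ[ℝ] ℝ) (fun v => by
      have h := hG (u + v)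
      rw [add_sub_cancel_left] at h
      refine h.trans (le_of_eq (integral_congr_ae ?_))
      filter_upwards [fieldAt_add U (T v)] with x hx
      rw [hamIncr, ← hx]
      rfl)
  obtain ⟨S, hS⟩ := exists_subgradient_field hΩ hb ha hf hC0 hC U
  let A : Space d → Mat d := fun x => if 0 < m x then (m x)⁻¹ • fieldAt B x else fieldAt S x
  have hmeas : ∀ i j, Measurable fun x => A x i j := by
    intro i j
    have hmm : Measurable (m : Space d → ℝ) := (Lp.stronglyMeasurable m).measurable
    have e : (fun x => A x i j) =
        fun x => if 0 < m x then (m x)⁻¹ * fieldAt B x i j else fieldAt S x i j := by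
      funext x
      by_cases h : 0 < m x <;> simp [A, h]
    rw [e]
    exact Measurable.ite (measurableSet_lt measurable_const hmm)
      (hmm.inv.mul (measurable_fieldAt B i j)) (measurable_fieldAt S i j)
  have hA : ∀ᵐ x ∂(volume.restrict Ω),
      (A x ∈ subdiff a f x (hess u x) ∧ ∀ i j, |A x i j| ≤ C) ∧ m x • A x = fieldAt B x := by
    filter_upwards [hm, hB, hS, ae_restrict_mem hΩ.measurableSet] with x hmx hBx hSx hx
    rcases hmx.lt_or_eq with hpos | hzero
    · have e : A x = (m x)⁻¹ • fieldAt B x := if_pos hpos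
      refine ⟨(hC x (subset_closure hx)).mem_subdiff fun Z => ?_, ?_⟩
      · rw [e, smul_frob, inv_mul_le_iff₀ hpos]
        exact hBx Z
      · rw [e, smul_inv_smul₀ hpos.ne']
    · have e : A x = fieldAt S x := if_neg (by rw [← hzero]; exact lt_irrefl 0)
      refine ⟨(hC x (subset_closure hx)).mem_subdiff fun Z => ?_, ?_⟩
      · rw [e]
        exact hSx Z
      · rw [← hzero, zero_smul]
        ext i j
        have h1 := hBx (Matrix.single i j 1)
        have h2 := hBx (Matrix.single i j (-1))
        rw [← hzero, zero_mul, frob_single] at h1 h2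
        rw [Matrix.zero_apply]
        linarith
  have hLp : ∀ i j, MemLp (fun x => A x i j) ∞ (volume.restrict Ω) := fun i j =>
    memLp_top_of_bound (hmeas i j).aestronglyMeasurable C (hA.mono fun x hx => hx.1.2 i j)
  let A' : Matrix (Fin d) (Fin d) (LInfty Ω) := fun i j => (hLp i j).toLp _
  have hA' : ∀ᵐ x ∂(volume.restrict Ω), matAt A' x = A x := by
    filter_upwards [ae_all_iff.2 fun i => ae_all_iff.2 fun j => (hLp i j).coeFn_toLp] with x hx
    ext i j
    exact hx i j
  refine ⟨-A', ?_, hu, fun v => ?_⟩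
  · rw [neg_neg]
    filter_upwards [hA, hA'] with x hx e
    rw [e]
    exact hx.1.1
  · rw [neg_neg]
    refine Eq.trans (integral_congr_ae ?_) (hBG v)
    filter_upwards [hA, hA'] with x hx e
    rw [e, ← smul_frob, hx.2]
    rfl

end Solutions

end MeanFieldGame

open MeanFieldGame in
theorem theorem3p1 {d : ℕ} (hd : 1 ≤ d) (Ω : Set (Space d)) (hΩ_open : IsOpen Ω)
    (hΩ_bdd : Bornology.IsBounded Ω)
    {𝒜 : Type*} [MetricSpace 𝒜] [CompactSpace 𝒜] [Nonempty 𝒜]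
    (a : Space d → 𝒜 → Mat d) (f : Space d → 𝒜 → ℝ)
    (ha_symm : ∀ x ∈ closure Ω, ∀ α, (a x α).IsSymm)
    (ha_cont : ContinuousOn (fun p : Space d × 𝒜 => a p.1 p.2) (closure Ω ×ˢ Set.univ))
    (hf_cont : ContinuousOn (fun p : Space d × 𝒜 => f p.1 p.2) (closure Ω ×ˢ Set.univ))
    (F : L2 Ω → L2 Ω) (G : StrongDual ℝ (V Ω)) (u : V Ω) (m : L2 Ω) :
    ((IsPDISolution a f F G u m ∧ ∀ᵐ x ∂(volume.restrict Ω), 0 ≤ m x) →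
      IsVISolution a f F G u m) ∧
    (IsVISolution a f F G u m → IsPDISolution a f F G u m) := by
  exact ⟨fun h => h.1.isVISolution hΩ_open hΩ_bdd ha_cont hf_cont h.2,
    fun h => h.isPDISolution hΩ_open hΩ_bdd ha_symm ha_cont hf_cont⟩
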